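/- Let $a,b\in\mathbb Z_{\ge 2}\cup\{\infty\}$ be such that the triple $(a,b,\infty)$ is hyperbolic, i.e. $\frac1a+\frac1b<1$ (with $\frac1\infty=0$). Let $\Delta=\Delta(a,b,\infty)\le \mathrm{PSL}_2(\mathbb R)$ be the triangle group of this signature, i.e. the orientation-preserving subgroup of the group generated by the reflections in the sides of a hyperbolic triangle with angles $\pi/a,\pi/b,0$ (well defined up to isometry of the hyperbolic plane). Let $\Delta^{(2)}\le \mathrm{SL}_2(\mathbb R)$ be the subgroup generated by $-1$ and the squares of the elements of the preimage of $\Delta$ in $\mathrm{SL}_2(\mathbb R)$, let $E=\mathbb Q(\operatorname{Tr}\Delta^{(2)})$ be the invariant trace field, and let $A\subseteq \mathrm{M}_2(\mathbb R)$ be the quaternion algebra over $E$ generated over $E$ by $\Delta^{(2)}$. For $r\in\mathbb Z_{\ge1}$, the triple $(a,b,\infty)$ is called $r$-arithmetic if exactly $r$ embeddings $\sigma\colon E\hookrightarrow\mathbb R$ split $A$, i.e. satisfy $\mathbb R\otimes_{E,\sigma}A\simeq \mathrm M_2(\mathbb R)$ as $\mathbb R$-algebras. Suppose that $(a,b,\infty)$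 is $r$-arithmetic with $r\ge 1$. Let $m=\operatorname{lcm}(\{a,b\}\smallsetminus\{\infty\})$ (with $\operatorname{lcm}(\emptyset)=1$), and let $q$ be the $r$th nondividing prime of $2m$, i.e. the prime $q\nmid 2m$ such that there are exactly $r-1$ primes $p<q$ with $p\nmid 2m$. If $b\ne\infty$, then $b\le 2q$; and if $a\neq\infty$, then $a\le 2q$. -/

import Mathlib

open scoped TensorProduct MatrixGroups

noncomputable section

namespace TriangleGroup

/-- The real number `1 / s` for `s ∈ ℤ_{≥ 1} ∪ {∞}`, with `1 / ∞ = 0`. -/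
def recip (s : ℕ∞) : ℝ :=
  if s = ⊤ then 0 else 1 / (s.toNat : ℝ)

/-- The angular excess `χ(a,b,c) = 1/a + 1/b + 1/c - 1` (in units of `π`). -/
def chi (a b c : ℕ∞) : ℝ :=
  recip a + recip b + recip c - 1

/-- A hyperbolic signature: `a, b, c ∈ ℤ_{≥ 2} ∪ {∞}` with `χ(a,b,c) < 0`. -/
structure IsHyperbolic (a b c : ℕ∞) : Prop where
  two_le_left : 2 ≤ a
  two_le_mid : 2 ≤ b
  two_le_right : 2 ≤ c
  chi_neg : chi a b c < 0

/-- The trace `λ_{2s} = 2 cos (π / s)`, with `λ_∞ = 2`. -/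
def lam2 (s : ℕ∞) : ℝ :=
  2 * Real.cos (Real.pi * recip s)

/-- `δ_a, δ_b, δ_c ∈ SL₂(ℝ)` are lifts of the standard generators of the triangle group
`Δ(a,b,c) ≤ PSL₂(ℝ)`: the rotations through `2π/a, 2π/b, 2π/c` about the vertices of a hyperbolic
triangle with angles `π/a, π/b, π/c` (a parabolic element at a vertex with angle `π/∞ = 0`), with
the lifts normalized so that the traces are `2 cos (π/a), 2 cos (π/b), 2 cos (π/c)`;
the product of these lifts is `-1`. For a hyperbolic signature such a triple exists and
is unique up to simultaneous conjugation by an element of `GL₂(ℝ)`. -/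
structure IsStandardTriple (a b c : ℕ∞) (δa δb δc : SL(2, ℝ)) : Prop where
  trace_left : (δa : Matrix (Fin 2) (Fin 2) ℝ).trace = lam2 a
  trace_mid : (δb : Matrix (Fin 2) (Fin 2) ℝ).trace = lam2 b
  trace_right : (δc : Matrix (Fin 2) (Fin 2) ℝ).trace = lam2 c
  prod_eq : δa * δb * δc = -1

/-- `Γ ≤ SL₂(ℝ)` is the preimage of a triangle group `Δ(a,b,c) ≤ PSL₂(ℝ)`
of hyperbolic signature `(a,b,c)`. (The element `-1` belongs to `Γ`, as `δ_a δ_b δ_c = -1`.) -/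
def IsTrianglePreimage (a b c : ℕ∞) (Γ : Subgroup SL(2, ℝ)) : Prop :=
  IsHyperbolic a b c ∧
    ∃ δa δb δc : SL(2, ℝ), IsStandardTriple a b c δa δb δc ∧
      Γ = Subgroup.closure {δa, δb, δc}

/-- The subgroup `Γ^(2)` generated by `-1` and the squares `γ²` for `γ ∈ Γ`. -/
def squareSubgroup (Γ : Subgroup SL(2, ℝ)) : Subgroup SL(2, ℝ) :=
  Subgroup.closure (insert (-1) {g | ∃ γ ∈ Γ, g = γ ^ 2})

/-- The invariant trace field `E = ℚ(Tr Γ^(2)) ⊆ ℝ`. -/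
def invariantTraceField (Γ : Subgroup SL(2, ℝ)) : IntermediateField ℚ ℝ :=
  IntermediateField.adjoin ℚ
    {t | ∃ γ ∈ squareSubgroup Γ, t = (γ : Matrix (Fin 2) (Fin 2) ℝ).trace}

/-- The invariant quaternion algebra `A = E[Γ^(2)] ⊆ M₂(ℝ)`: the `E`-subalgebra of `M₂(ℝ)`
generated by `Γ^(2)`. -/
def invariantAlgebra (Γ : Subgroup SL(2, ℝ)) :
    Subalgebra (invariantTraceField Γ) (Matrix (Fin 2) (Fin 2) ℝ) :=
  Algebra.adjoin (invariantTraceField Γ)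
    {M | ∃ γ ∈ squareSubgroup Γ, M = (γ : Matrix (Fin 2) (Fin 2) ℝ)}

/-- The `E`-algebra `A` is split at the real place given by the embedding `σ : E → ℝ`:
`ℝ ⊗_{E,σ} A ≃ M₂(ℝ)` as `ℝ`-algebras. -/
def IsSplitAt {E A : Type} [Field E] [Ring A] [Algebra E A] (σ : E →+* ℝ) : Prop :=
  letI : Algebra E ℝ := σ.toAlgebra
  Nonempty ((ℝ ⊗[E] A) ≃ₐ[ℝ] Matrix (Fin 2) (Fin 2) ℝ)

/-- The number of split real places of the invariant quaternion algebra of `Γ`. The real places of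
`E` are the embeddings `E → ℝ`. -/
def arithmeticDimension (Γ : Subgroup SL(2, ℝ)) : ℕ :=
  Nat.card {σ : invariantTraceField Γ →+* ℝ // IsSplitAt (A := invariantAlgebra Γ) σ}

/-- The signature `(a,b,c)` is `r`-arithmetic: it is hyperbolic and its triangle group, which is
unique up to conjugation, has arithmetic dimension `r`. -/
def IsArithmetic (r : ℕ) (a b c : ℕ∞) : Prop :=
  ∃ Γ : Subgroup SL(2, ℝ), IsTrianglePreimage a b c Γ ∧ arithmeticDimension Γ = r

/-- `m = lcm ({a, b, c} ∖ {∞})`, with `lcm ∅ = 1`. -/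
def lcmFinite (a b c : ℕ∞) : ℕ :=
  (({a, b, c} : Finset ℕ∞).erase ⊤).lcm ENat.toNat

/-- `q` is the `r`th nondividing prime of `n`: a prime with `q ∤ n` such that there are exactly
`r - 1` primes `p < q` with `p ∤ n`. -/
def IsNondividingPrime (r n q : ℕ) : Prop :=
  q.Prime ∧ ¬ q ∣ n ∧ ((Finset.range q).filter fun p => p.Prime ∧ ¬ p ∣ n).card + 1 = r

end TriangleGroup

end

open scoped TensorProduct MatrixGroups

noncomputable section

/-! The cusp makes every real place split. As δ_c is parabolic, δ_c² - 1 is a nonzero nilpotent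
element of A, so A ≃ M₂(E), and r is just the number of embeddings E → ℝ
(`nonempty_invariantAlgebra_algEquiv`, `isSplitAt`).

These embeddings are bounded below by Galois theory. By Fricke's trace identities E lies in
ℚ(cos(2π/2m)), and E contains 2cos(2π/n) for n = a or n = b, if finite. Each k prime to 2m gives an
embedding sending 2cos(2π/n) to 2cos(2πk/n); for 0 ≤ k ≤ n/2 these values are distinct
(`card_le_arithmeticDimension`). If n > 2q, then k = 1 and the first r primes not dividing 2m give r
+ 1 embeddings, a contradiction. -/

/-- Conjugation by a unit, as an algebra automorphism. -/
def Units.conjAlgEquiv (F : Type*) {R : Type*} [CommSemiring F] [Ring R] [Algebra F R] (u : Rˣ) :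
    R ≃ₐ[F] R :=
  AlgEquiv.ofAlgHom
    (AlgHom.ofLinearMap (LinearMap.mulLeftRight F ((u : R), (↑u⁻¹ : R)))
      (by simp) (by intro x y; simp [mul_assoc]))
    (AlgHom.ofLinearMap (LinearMap.mulLeftRight F ((↑u⁻¹ : R), (u : R)))
      (by simp) (by intro x y; simp [mul_assoc]))
    (by ext x; simp [mul_assoc]) (by ext x; simp [mul_assoc])

theorem Units.conjAlgEquiv_apply (F : Type*) {R : Type*} [CommSemiring F] [Ring R] [Algebra F R]
    (u : Rˣ) (x : R) : u.conjAlgEquiv F x = u * x * ↑u⁻¹ := by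
  simp [Units.conjAlgEquiv]

/-! ### Recognizing M₂(F) inside M₂(L) by a nilpotent element -/

namespace Matrix

variable {F L : Type*} [Field F] [Field L] [Algebra F L]

/-- A singular n is an outer product u vᵀ, so n y n = (vᵀ y u) n. -/
theorem mul_mul_self_of_sq_eq_zero {n : Matrix (Fin 2) (Fin 2) L} (hn : n * n = 0)
    (y : Matrix (Fin 2) (Fin 2) L) : n * y * n = (n * y).trace • n := by
  have hd : n.det = 0 := by
    have := congrArg det hn
    simpa using this
  rw [det_fin_two] at hd
  ext i j
  fin_cases i <;> fin_cases j <;> simp [Matrix.mul_apply, trace_fin_two, Fin.sum_univ_two]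
  · linear_combination (-y 1 1) * hd
  · linear_combination y 0 1 * hd
  · linear_combination y 1 0 * hd
  · linear_combination (-y 0 0) * hd

/-- A nonzero square-zero matrix `n` and a matrix `y` with `tr (n y) = 1` are brought into standard
form by a common change of basis. -/
theorem exists_unit_conj {n y : Matrix (Fin 2) (Fin 2) L} (hn : n * n = 0) (hn0 : n ≠ 0)
    (hy : (n * y).trace = 1) :
    ∃ (P : (Matrix (Fin 2) (Fin 2) L)ˣ) (β δ : L), (P : Matrix (Fin 2) (Fin 2) L) * n * (↑P⁻¹ : Matrix (Fin 2) (Fin 2) L) = !![0, 1; 0, 0] ∧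
      (P : Matrix (Fin 2) (Fin 2) L) * y * (↑P⁻¹ : Matrix (Fin 2) (Fin 2) L) = !![0, β; 1, δ] := by
  obtain ⟨v, hv⟩ : ∃ v, n *ᵥ v ≠ 0 := by
    by_contra! h
    exact hn0 (Matrix.ext_of_mulVec_single fun i => by rw [h, zero_mulVec])
  set u := n *ᵥ v with hu
  have hnu : n *ᵥ u = 0 := by rw [hu, mulVec_mulVec, hn, zero_mulVec]
  have hnyu : n *ᵥ (y *ᵥ u) = u := by
    rw [hu, mulVec_mulVec, mulVec_mulVec, mul_mul_self_of_sq_eq_zero hn, hy, one_smul]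
  -- In the basis u, y u the matrix n sends u to 0 and y u to u, while y sends u to the second basis
  -- vector. The base change P is Q⁻¹.
  set Q : Matrix (Fin 2) (Fin 2) L := (Matrix.of ![u, y *ᵥ u])ᵀ with hQ
  have hQv (w : Fin 2 → L) : Q *ᵥ w = w 0 • u + w 1 • (y *ᵥ u) := by
    ext i
    fin_cases i <;> simp [hQ, mulVec, dotProduct, Fin.sum_univ_two] <;> ring
  have hQdet : Q.det ≠ 0 := by
    intro h
    obtain ⟨w, hw, hw0⟩ := exists_mulVec_eq_zero_iff.mpr h
    rw [hQv] at hw0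
    have h1 : w 1 = 0 := by
      have := congrArg (n *ᵥ ·) hw0
      simp only [mulVec_add, mulVec_smul, hnu, hnyu, smul_zero, zero_add, mulVec_zero] at this
      exact (smul_eq_zero.mp this).resolve_right hv
    rw [h1, zero_smul, add_zero] at hw0
    have h0 := (smul_eq_zero.mp hw0).resolve_right hv
    exact hw (by ext i; fin_cases i <;> simp [h0, h1])
  have hQu : IsUnit Q := (Q.isUnit_iff_isUnit_det).mpr (isUnit_iff_ne_zero.mpr hQdet)
  obtain ⟨U, hU⟩ := hQu
  set Y := (↑U⁻¹ : Matrix (Fin 2) (Fin 2) L) * y * U with hY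
  have hUY : Q * Y = y * Q := by
    rw [hY, ← hU, ← mul_assoc, ← mul_assoc, Units.mul_inv, one_mul]
  have hUN : Q * !![0, 1; 0, 0] = n * Q := by
    refine Matrix.ext_of_mulVec_single fun i => ?_
    rw [← mulVec_mulVec, ← mulVec_mulVec, hQv, hQv]
    rw [mulVec_add, mulVec_smul, mulVec_smul, hnu, hnyu]
    fin_cases i <;> simp
  have hYcol : Y *ᵥ Pi.single 0 1 = Pi.single 1 1 := by
    have hinj : Function.Injective (Q *ᵥ ·) :=
      mulVec_injective_iff_isUnit.mpr ⟨U, hU⟩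
    apply hinj
    simp only [mulVec_mulVec]
    rw [hUY, ← mulVec_mulVec, hQv, hQv]
    simp
  refine ⟨U⁻¹, Y 0 1, Y 1 1, ?_, ?_⟩
  · rw [inv_inv, mul_assoc, hU, ← hUN, ← hU, Units.inv_mul_cancel_left]
  · rw [inv_inv, ← hY]
    have h0 := congrFun hYcol 0
    have h1 := congrFun hYcol 1
    simp at h0 h1
    ext i j
    fin_cases i <;> fin_cases j <;> simp [h0, h1]

/-- A subalgebra of `M₂(L)` over a subfield `F` that has traces in `F` and contains the matrix
unit `e₁₂` and a matrix with first column `(0, 1)` is `M₂(F)`. -/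
theorem subalgebra_eq_range_mapMatrix (A : Subalgebra F (Matrix (Fin 2) (Fin 2) L))
    (htr : ∀ x ∈ A, x.trace ∈ (algebraMap F L).range) {β δ : L}
    (hn : !![0, 1; 0, 0] ∈ A) (hy : !![0, β; 1, δ] ∈ A) :
    A = ((Algebra.ofId F L).mapMatrix (m := Fin 2)).range := by
  have h22 : (!![0, 0; 0, 1] : Matrix (Fin 2) (Fin 2) L) ∈ A := by
    simpa using mul_mem hy hn
  have h11 : (!![1, 0; 0, 0] : Matrix (Fin 2) (Fin 2) L) ∈ A := by
    convert sub_mem (one_mem A) h22 using 1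
    ext i j
    fin_cases i <;> fin_cases j <;> simp
  have h21 : (!![0, 0; 1, 0] : Matrix (Fin 2) (Fin 2) L) ∈ A := by
    convert mul_mem (mul_mem h22 hy) h11 using 1
    ext i j
    fin_cases i <;> fin_cases j <;> simp
  apply le_antisymm
  · intro x hx
    -- The entry x i j is the trace of x times the matrix unit at (j, i).
    have h (i j) : ∃ c : F, algebraMap F L c = x i j := by
      fin_cases i <;> fin_cases j
      · simpa [trace_fin_two, vecMul, Matrix.mul_apply] using htr _ (mul_mem hx h11)
      · simpa [trace_fin_two, vecMul, Matrix.mul_apply] using htr _ (mul_mem hx h21)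
      · simpa [trace_fin_two, vecMul, Matrix.mul_apply] using htr _ (mul_mem hx hn)
      · simpa [trace_fin_two, vecMul, Matrix.mul_apply] using htr _ (mul_mem hx h22)
    choose X hX using h
    exact ⟨Matrix.of X, by ext i j; simpa [Algebra.ofId_apply] using hX i j⟩
  · rintro _ ⟨X, rfl⟩
    have key : (Algebra.ofId F L).mapMatrix X = X 0 0 • !![1, 0; 0, 0] + X 0 1 • !![0, 1; 0, 0] +
        X 1 0 • !![0, 0; 1, 0] + X 1 1 • !![(0 : L), 0; 0, 1] := by
      ext i j
      fin_cases i <;> fin_cases j <;> simp [Algebra.ofId_apply, Algebra.algebraMap_eq_smul_one]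
    change (Algebra.ofId F L).mapMatrix X ∈ A
    rw [key]
    exact add_mem (add_mem (add_mem (A.smul_mem h11 _) (A.smul_mem hn _)) (A.smul_mem h21 _))
      (A.smul_mem h22 _)

/-- Rescaling y by an element of F makes the trace 1. Conjugation then preserves traces and carries
A onto M₂(F); no assumption on the dimension of A is needed. -/
theorem nonempty_subalgebra_algEquiv (A : Subalgebra F (Matrix (Fin 2) (Fin 2) L))
    (htr : ∀ x ∈ A, x.trace ∈ (algebraMap F L).range) {n y : Matrix (Fin 2) (Fin 2) L}
    (hnA : n ∈ A) (hyA : y ∈ A) (hn : n * n = 0) (hn0 : n ≠ 0) (hny : (n * y).trace ≠ 0) :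
    Nonempty (A ≃ₐ[F] Matrix (Fin 2) (Fin 2) F) := by
  obtain ⟨c, hc⟩ := htr _ (mul_mem hnA hyA)
  have hcy : (n * (c⁻¹ • y)).trace = 1 := by
    rw [mul_smul_comm, trace_smul, Algebra.smul_def, map_inv₀, hc, inv_mul_cancel₀ hny]
  obtain ⟨P, β, δ, hPn, hPy⟩ := exists_unit_conj hn hn0 hcy
  let f := P.conjAlgEquiv F
  have hrange : A.map (f : Matrix (Fin 2) (Fin 2) L →ₐ[F] Matrix (Fin 2) (Fin 2) L) = ((Algebra.ofId F L).mapMatrix (m := Fin 2)).range := by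
    refine subalgebra_eq_range_mapMatrix _ ?_ (β := β) (δ := δ) ?_ ?_
    · rintro _ ⟨x, hx, rfl⟩
      have : (f x).trace = x.trace := by
        rw [P.conjAlgEquiv_apply F, trace_mul_comm, Units.inv_mul_cancel_left]
      change (f x).trace ∈ _
      rw [this]
      exact htr x hx
    · exact ⟨n, hnA, (P.conjAlgEquiv_apply F n).trans hPn⟩
    · exact ⟨c⁻¹ • y, A.smul_mem hyA _, (P.conjAlgEquiv_apply F _).trans hPy⟩
  have hinj : Function.Injective ((Algebra.ofId F L).mapMatrix (m := Fin 2)) := by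
    intro X Y h
    ext i j
    exact (algebraMap F L).injective (congrFun (congrFun h i) j)
  exact ⟨(A.equivMapOfInjective (f : Matrix (Fin 2) (Fin 2) L →ₐ[F] Matrix (Fin 2) (Fin 2) L) f.injective).trans
    ((Subalgebra.equivOfEq _ _ hrange).trans (AlgEquiv.ofInjective _ hinj).symm)⟩

end Matrix

namespace TriangleGroup

theorem isSplitAt_of_algEquiv_matrix {E A : Type} [Field E] [Ring A] [Algebra E A]
    (e : A ≃ₐ[E] Matrix (Fin 2) (Fin 2) E) (σ : E →+* ℝ) : IsSplitAt (A := A) σ := by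
  let : Algebra E ℝ := σ.toAlgebra
  -- `matrixEquivTensor` is E-linear; linearity over ℝ is checked on pure tensors.
  let g : (ℝ ⊗[E] Matrix (Fin 2) (Fin 2) E) ≃ₐ[ℝ] Matrix (Fin 2) (Fin 2) ℝ :=
    AlgEquiv.ofLinearEquiv
      { (matrixEquivTensor (Fin 2) E ℝ).symm with
        map_smul' := fun c x => by
          induction x with
          | zero => simp
          | tmul a M =>
            ext i j
            simp [TensorProduct.smul_tmul', matrixEquivTensor_apply_symm, mul_assoc]
          | add x y hx hy => simp_all [smul_add] }
      (map_one (matrixEquivTensor (Fin 2) E ℝ).symm)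
      (map_mul (matrixEquivTensor (Fin 2) E ℝ).symm)
  exact ⟨(Algebra.TensorProduct.congr AlgEquiv.refl e).trans g⟩

end TriangleGroup

/-! ### Real embeddings of ℚ(cos(2π/N)) -/

open Polynomial IntermediateField in
/-- The minimal polynomial of `cos (2π / N)` has `cos (2πk / N)` as a root, for `k` prime to `N`. -/
theorem Real.aeval_minpoly_cos_two_pi_mul_div {N k : ℕ} (hN : N ≠ 0) (hk : k.Coprime N) :
    aeval (Real.cos (k * (2 * Real.pi / N))) (minpoly ℚ (Real.cos (2 * Real.pi / N))) = 0 := by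
  set p := minpoly ℚ (Real.cos (2 * Real.pi / N)) with hp
  set ζ : ℂ := Complex.exp (2 * Real.pi * Complex.I / N) with hζ
  have hprim : IsPrimitiveRoot ζ N := Complex.isPrimitiveRoot_exp N hN
  have hcos (j : ℕ) :
      ((Real.cos (j * (2 * Real.pi / N)) : ℝ) : ℂ) = (ζ ^ j + (ζ ^ j) ^ (N - 1)) / 2 := by
    have h1 : (ζ ^ j) ^ (N - 1) = (ζ ^ j)⁻¹ := by
      refine eq_inv_of_mul_eq_one_left ?_
      rw [← pow_succ, Nat.sub_add_cancel (Nat.one_le_iff_ne_zero.mpr hN), ← pow_mul, mul_comm,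
        pow_mul, hprim.pow_eq_one, one_pow]
    rw [h1, Complex.ofReal_cos, Complex.cos, hζ, ← Complex.exp_nat_mul, ← Complex.exp_neg]
    push_cast
    congr 3 <;> ring_nf
  -- Since ζ⁻¹ = ζ^(N-1), this polynomial takes the value p(cos(2πj/N)) at ζ^j. It vanishes at ζ,
  -- hence at the conjugate ζ^k.
  set s : ℚ[X] := p.comp ((X + X ^ (N - 1)) * C (1 / 2)) with hs
  have hsz (j : ℕ) : aeval (ζ ^ j) s = ((aeval (Real.cos (j * (2 * Real.pi / N))) p : ℝ) : ℂ) := by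
    have : aeval (ζ ^ j) ((X + X ^ (N - 1)) * C (1 / 2) : ℚ[X]) =
        algebraMap ℝ ℂ (Real.cos (j * (2 * Real.pi / N))) := by
      rw [Complex.coe_algebraMap, hcos]
      simp [div_eq_mul_inv]
    rw [hs, aeval_comp, this, aeval_algebraMap_apply, Complex.coe_algebraMap]
  have h1 : aeval ζ s = 0 := by
    have := hsz 1
    rw [pow_one, Nat.cast_one, one_mul, hp, minpoly.aeval, Complex.ofReal_zero] at this
    exact this
  have h2 : aeval (ζ ^ k) s = 0 := by
    obtain ⟨t, ht⟩ := minpoly.dvd ℚ ζ h1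
    have hmin : minpoly ℚ ζ = minpoly ℚ (ζ ^ k) := by
      have hZ := hprim.minpoly_eq_pow_coprime hk
      have e1 := minpoly.isIntegrallyClosed_eq_field_fractions' ℚ
        (hprim.isIntegral (Nat.pos_of_ne_zero hN))
      have e2 := minpoly.isIntegrallyClosed_eq_field_fractions' ℚ
        ((hprim.isIntegral (Nat.pos_of_ne_zero hN)).pow k)
      rw [e1, e2, hZ]
    rw [ht, hmin, map_mul, minpoly.aeval, zero_mul]
  rw [hsz] at h2
  exact_mod_cast h2

open Polynomial IntermediateField in
theorem Real.cos_nat_mul_mem_adjoin (θ : ℝ) (j : ℕ) : Real.cos (j * θ) ∈ ℚ⟮Real.cos θ⟯ := by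
  have h : Real.cos (j * θ) = aeval (Real.cos θ) (Chebyshev.T ℚ j) := by
    rw [Chebyshev.aeval_T, Chebyshev.T_real_cos]; simp
  rw [h]
  exact algebra_adjoin_le_adjoin _ _ (Polynomial.aeval_mem_adjoin_singleton _ _)

open Polynomial IntermediateField in
/-- For `k` prime to `N`, the field `ℚ(cos (2π / N))` has a real embedding that multiplies the
angles `2πj / N` by `k`. -/
theorem Real.exists_ringHom_adjoin_cos {N k : ℕ} (hN : N ≠ 0) (hk : k.Coprime N) :
    ∃ φ : ℚ⟮Real.cos (2 * Real.pi / N)⟯ →+* ℝ, ∀ (j : ℕ) (x : ℚ⟮Real.cos (2 * Real.pi / N)⟯),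
      (x : ℝ) = Real.cos (j * (2 * Real.pi / N)) →
        φ x = Real.cos (j * (k * (2 * Real.pi / N))) := by
  set θ := 2 * Real.pi / N with hθ
  have hint : IsIntegral ℚ (Real.cos θ) := by
    have := (isAlgebraic_cos_rat_mul_pi (2 / N)).extendScalars
      (S := ℚ) (algebraMap ℤ ℚ).injective_int
    rw [isAlgebraic_iff_isIntegral] at this
    have h : ((2 / N : ℚ) : ℝ) * Real.pi = θ := by rw [hθ]; push_cast; ring
    rwa [h] at this
  have hroot := Real.aeval_minpoly_cos_two_pi_mul_div hN hk
  let φ : ℚ⟮Real.cos θ⟯ →ₐ[ℚ] ℝ := (algHomAdjoinIntegralEquiv ℚ hint).symm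
    ⟨Real.cos (k * θ), by
      rw [mem_aroots]
      exact ⟨minpoly.ne_zero hint, hroot⟩⟩
  have hφ : φ (AdjoinSimple.gen ℚ (Real.cos θ)) = Real.cos (k * θ) :=
    algHomAdjoinIntegralEquiv_symm_apply_gen ..
  refine ⟨φ, fun j x hx => ?_⟩
  have h : x = aeval (AdjoinSimple.gen ℚ (Real.cos θ)) (Chebyshev.T ℚ j) := by
    apply Subtype.ext
    rw [hx, ← IntermediateField.algebraMap_apply, ← aeval_algebraMap_apply, AdjoinSimple.algebraMap_gen,
      Chebyshev.aeval_T, Chebyshev.T_real_cos]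
    simp
  change φ x = _
  rw [h, ← Polynomial.aeval_algHom_apply, hφ, Chebyshev.aeval_T, Chebyshev.T_real_cos]
  simp

/-! ### Fricke's trace identities -/

namespace Matrix

variable {R : Type*} [CommRing R]

theorem mul_self_fin_two (A : Matrix (Fin 2) (Fin 2) R) :
    A * A = A.trace • A - A.det • (1 : Matrix (Fin 2) (Fin 2) R) := by
  ext i j
  fin_cases i <;> fin_cases j <;>
    simp [Matrix.mul_apply, Fin.sum_univ_two, trace_fin_two, det_fin_two] <;> ring

/-- The polarized Cayley–Hamilton identity. -/
theorem mul_add_mul_fin_two (A B : Matrix (Fin 2) (Fin 2) R) :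
    B * A = A.trace • B + B.trace • A + ((A * B).trace - A.trace * B.trace) •
      (1 : Matrix (Fin 2) (Fin 2) R) - A * B := by
  ext i j
  fin_cases i <;> fin_cases j <;>
    simp [Matrix.mul_apply, Fin.sum_univ_two, trace_fin_two] <;> ring

namespace SpecialLinearGroup

theorem coe_inv_fin_two (g : SL(2, R)) : ((g⁻¹ : SL(2, R)) : Matrix (Fin 2) (Fin 2) R) =
    (g : Matrix (Fin 2) (Fin 2) R).trace • (1 : Matrix (Fin 2) (Fin 2) R) - g := by
  rw [coe_inv, adjugate_fin_two]
  ext i j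
  fin_cases i <;> fin_cases j <;> simp [trace_fin_two]

variable {L : Type*} [Field L]

/-- Fricke: the traces on the group generated by `g`, `h` and `-1` lie in any field that contains the
traces of `g`, `h` and `g h`. -/
theorem trace_mem_of_mem_closure {K : Subfield L} {g h x : SL(2, L)}
    (hg : (g : Matrix (Fin 2) (Fin 2) L).trace ∈ K)
    (hh : (h : Matrix (Fin 2) (Fin 2) L).trace ∈ K)
    (hgh : ((g : Matrix (Fin 2) (Fin 2) L) * h).trace ∈ K)
    (hx : x ∈ Subgroup.closure {g, h, -1}) :
    (x : Matrix (Fin 2) (Fin 2) L).trace ∈ K := by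
  set G := (g : Matrix (Fin 2) (Fin 2) L) with hG
  set H := (h : Matrix (Fin 2) (Fin 2) L) with hH
  have hGG : G * G = G.trace • G - 1 := by rw [mul_self_fin_two, hG, det_coe, one_smul]
  have hHH : H * H = H.trace • H - 1 := by rw [mul_self_fin_two, hH, det_coe, one_smul]
  have hHG := mul_add_mul_fin_two G H
  -- S tests y against 1, G, H, GH. Cayley–Hamilton rewrites every longer product through these
  -- four, so S is stable under right multiplication by G and H.
  let S : Set (Matrix (Fin 2) (Fin 2) L) := {y | y.trace ∈ K ∧ (y * G).trace ∈ K ∧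
    (y * H).trace ∈ K ∧ (y * G * H).trace ∈ K}
  have hSsmul {c : L} (hc : c ∈ K) {y : Matrix (Fin 2) (Fin 2) L} (hy : y ∈ S) : c • y ∈ S := by
    obtain ⟨h1, h2, h3, h4⟩ := hy
    refine ⟨?_, ?_, ?_, ?_⟩ <;> simp only [smul_mul_assoc, trace_smul, smul_eq_mul] <;>
      exact mul_mem hc ‹_›
  have hSsub {y z : Matrix (Fin 2) (Fin 2) L} (hy : y ∈ S) (hz : z ∈ S) : y - z ∈ S := by
    obtain ⟨h1, h2, h3, h4⟩ := hy
    obtain ⟨k1, k2, k3, k4⟩ := hz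
    refine ⟨?_, ?_, ?_, ?_⟩ <;> simp only [sub_mul, trace_sub] <;> exact sub_mem ‹_› ‹_›
  have hS1 : (1 : Matrix (Fin 2) (Fin 2) L) ∈ S := by
    refine ⟨?_, by rwa [one_mul], by rwa [one_mul], by rwa [one_mul]⟩
    rw [trace_one]
    exact natCast_mem K _
  have hSG {y : Matrix (Fin 2) (Fin 2) L} (hy : y ∈ S) : y * G ∈ S := by
    obtain ⟨h1, h2, h3, h4⟩ := hy
    refine ⟨h2, ?_, h4, ?_⟩
    · rw [mul_assoc, hGG, mul_sub, mul_smul_comm, mul_one, trace_sub, trace_smul]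
      exact sub_mem (mul_mem hg h2) h1
    · rw [mul_assoc y, hGG, mul_sub, mul_smul_comm, mul_one, sub_mul, smul_mul_assoc, trace_sub,
        trace_smul]
      exact sub_mem (mul_mem hg h4) h3
  have hSH {y : Matrix (Fin 2) (Fin 2) L} (hy : y ∈ S) : y * H ∈ S := by
    have hyG := hSG hy
    obtain ⟨h1, h2, h3, h4⟩ := hy
    have hHG' : (y * H * G).trace ∈ K := by
      rw [mul_assoc, hHG, mul_sub, mul_add, mul_add]
      simp only [mul_smul_comm, mul_one, trace_sub, trace_add, trace_smul, smul_eq_mul,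
        ← mul_assoc]
      exact sub_mem (add_mem (add_mem (mul_mem hg h3) (mul_mem hh h2))
        (mul_mem (sub_mem hgh (mul_mem hg hh)) h1)) h4
    refine ⟨h3, hHG', ?_, ?_⟩
    · rw [mul_assoc, hHH, mul_sub, mul_smul_comm, mul_one, trace_sub, trace_smul]
      exact sub_mem (mul_mem hh h3) h1
    · have e : H * G * H = (G * H).trace • H + G.trace • (-1 : Matrix (Fin 2) (Fin 2) L) + G := by
        rw [hHG, sub_mul, add_mul, add_mul, smul_mul_assoc, smul_mul_assoc, smul_mul_assoc, one_mul,
          mul_assoc, hHH, mul_sub, mul_smul_comm, mul_one]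
        module
      rw [mul_assoc y, mul_assoc y, e]
      simp only [mul_add, mul_smul_comm, mul_neg, mul_one, trace_add, trace_smul, trace_neg,
        smul_eq_mul]
      exact add_mem (add_mem (mul_mem hgh h3) (neg_mem (mul_mem hg h1))) h2
  suffices hxS : ∀ y ∈ S, y * (x : Matrix (Fin 2) (Fin 2) L) ∈ S by simpa using (hxS 1 hS1).1
  induction hx using Subgroup.closure_induction with
  | mem z hz =>
    rcases hz with rfl | rfl | rfl
    exacts [fun y => hSG, fun y => hSH, fun y hy => by
      simpa using hSsmul (neg_mem (one_mem K)) hy]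
  | one => simp
  | mul z w _ _ hz hw =>
    intro y hy
    rw [coe_mul, ← mul_assoc]
    exact hw _ (hz _ hy)
  | inv z _ hz =>
    intro y hy
    -- z⁻¹ = tr(z) - z, and tr(z) ∈ K because 1 · z ∈ S.
    rw [coe_inv_fin_two, mul_sub, mul_smul_comm, mul_one]
    exact hSsub (hSsmul (by simpa using (hz 1 hS1).1) hy) (hz y hy)

end SpecialLinearGroup

end Matrix

/-! ### Traces on Γ and on the invariant algebra -/

namespace TriangleGroup

variable {a b c : ℕ∞} {δa δb δc : SL(2, ℝ)} {Γ : Subgroup SL(2, ℝ)}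

theorem squareSubgroup_le (hΓ : -1 ∈ Γ) : squareSubgroup Γ ≤ Γ := by
  refine (Subgroup.closure_le _).mpr ?_
  rintro _ (rfl | ⟨γ, hγ, rfl⟩)
  exacts [hΓ, pow_mem hγ 2]

theorem sq_mem_squareSubgroup {γ : SL(2, ℝ)} (hγ : γ ∈ Γ) : γ ^ 2 ∈ squareSubgroup Γ :=
  Subgroup.subset_closure (Or.inr ⟨γ, hγ, rfl⟩)

theorem trace_mem_invariantTraceField {γ : SL(2, ℝ)} (hγ : γ ∈ squareSubgroup Γ) :
    (γ : Matrix (Fin 2) (Fin 2) ℝ).trace ∈ invariantTraceField Γ :=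
  IntermediateField.subset_adjoin _ _ ⟨γ, hγ, rfl⟩

theorem coe_mem_invariantAlgebra {γ : SL(2, ℝ)} (hγ : γ ∈ squareSubgroup Γ) :
    (γ : Matrix (Fin 2) (Fin 2) ℝ) ∈ invariantAlgebra Γ :=
  Algebra.subset_adjoin ⟨γ, hγ, rfl⟩

/-- Γ^(2) is closed under products, so A is its E-linear span, and the trace is linear. -/
theorem trace_mem_of_mem_invariantAlgebra {x : Matrix (Fin 2) (Fin 2) ℝ}
    (hx : x ∈ invariantAlgebra Γ) :
    x.trace ∈ (algebraMap (invariantTraceField Γ) ℝ).range := by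
  rw [invariantAlgebra, ← Subalgebra.mem_toSubmodule, Algebra.adjoin_eq_span] at hx
  induction hx using Submodule.span_induction with
  | mem z hz =>
    obtain ⟨γ, hγ, rfl⟩ : ∃ γ ∈ squareSubgroup Γ, z = (γ : Matrix (Fin 2) (Fin 2) ℝ) := by
      induction hz using Submonoid.closure_induction with
      | mem z hz => exact hz
      | one => exact ⟨1, one_mem _, by simp⟩
      | mul z w _ _ hz hw =>
        obtain ⟨γ, hγ, rfl⟩ := hz
        obtain ⟨γ', hγ', rfl⟩ := hw
        exact ⟨γ * γ', mul_mem hγ hγ', by simp⟩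
    exact ⟨⟨_, trace_mem_invariantTraceField hγ⟩, rfl⟩
  | zero => simp
  | add z w _ _ hz hw => rw [Matrix.trace_add]; exact add_mem hz hw
  | smul e z _ hz =>
    rw [Matrix.trace_smul, Algebra.smul_def]
    exact mul_mem ⟨e, rfl⟩ hz

theorem IsStandardTriple.neg_one_mem (h : IsStandardTriple a b c δa δb δc) :
    -1 ∈ Subgroup.closure {δa, δb, δc} := by
  rw [← h.prod_eq]
  exact mul_mem (mul_mem (Subgroup.subset_closure (by simp)) (Subgroup.subset_closure (by simp)))
    (Subgroup.subset_closure (by simp))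

theorem IsStandardTriple.eq_neg_inv (h : IsStandardTriple a b c δa δb δc) :
    δc = -(δa * δb)⁻¹ := by
  rw [eq_inv_mul_of_mul_eq h.prod_eq, mul_neg_one]

theorem trace_inv (g : SL(2, ℝ)) : ((g⁻¹ : SL(2, ℝ)) : Matrix (Fin 2) (Fin 2) ℝ).trace =
    (g : Matrix (Fin 2) (Fin 2) ℝ).trace := by
  rw [Matrix.SpecialLinearGroup.coe_inv, Matrix.adjugate_fin_two]; simp [Matrix.trace_fin_two, add_comm]

theorem IsStandardTriple.trace_mem (h : IsStandardTriple a b c δa δb δc) {K : Subfield ℝ}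
    (ha : lam2 a ∈ K) (hb : lam2 b ∈ K) (hc : lam2 c ∈ K) {x : SL(2, ℝ)}
    (hx : x ∈ Subgroup.closure {δa, δb, δc}) : (x : Matrix (Fin 2) (Fin 2) ℝ).trace ∈ K := by
  have hab : δa * δb = -δc⁻¹ := by rw [h.eq_neg_inv]; simp
  refine Matrix.SpecialLinearGroup.trace_mem_of_mem_closure (g := δa) (h := δb)
    (h.trace_left ▸ ha) (h.trace_mid ▸ hb) ?_ ((Subgroup.closure_le _).mpr ?_ hx)
  · rw [← Matrix.SpecialLinearGroup.coe_mul, hab, Matrix.SpecialLinearGroup.coe_neg,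
      Matrix.trace_neg, trace_inv, h.trace_right]
    exact neg_mem hc
  · have hA : δa ∈ Subgroup.closure {δa, δb, -1} := Subgroup.subset_closure (by simp)
    have hB : δb ∈ Subgroup.closure {δa, δb, -1} := Subgroup.subset_closure (by simp)
    have hneg : (-1 : SL(2, ℝ)) ∈ Subgroup.closure {δa, δb, -1} :=
      Subgroup.subset_closure (by simp)
    rintro _ (rfl | rfl | rfl)
    · exact hA
    · exact hB
    · rw [h.eq_neg_inv, ← neg_one_mul (δa * δb)⁻¹]
      exact mul_mem hneg (inv_mem (mul_mem hA hB))

end TriangleGroup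

/-! ### Splitting from the parabolic generator -/

namespace TriangleGroup

variable {a b c : ℕ∞} {δa δb δc : SL(2, ℝ)} {Γ : Subgroup SL(2, ℝ)}

theorem recip_natCast (n : ℕ) : recip n = 1 / n := by simp [recip]

theorem lam2_natCast (n : ℕ) : lam2 n = 2 * Real.cos (Real.pi / n) := by
  rw [lam2, recip_natCast, mul_one_div]

theorem lam2_top : lam2 ⊤ = 2 := by simp [lam2, recip]

theorem lam2_two : lam2 2 = 0 := by
  have := lam2_natCast 2
  simpa using this

theorem lam2_pos {s : ℕ∞} (hs : 2 < s) : 0 < lam2 s := by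
  induction s with
  | top => rw [lam2_top]; norm_num
  | coe n =>
    have hn : 2 < n := by exact_mod_cast hs
    have hn' : (2 : ℝ) < n := by exact_mod_cast hn
    have := Real.pi_pos
    rw [lam2_natCast]
    refine mul_pos two_pos (Real.cos_pos_of_mem_Ioo ⟨?_, ?_⟩)
    · have : 0 < Real.pi / n := by positivity
      linarith
    · gcongr

theorem lam2_nonneg {s : ℕ∞} (hs : 2 ≤ s) : 0 ≤ lam2 s := by
  rcases hs.eq_or_lt with rfl | hs
  exacts [lam2_two.ge, (lam2_pos hs).le]

/-- The signature (2, 2, ∞) has χ = 0. -/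
theorem IsHyperbolic.two_lt_or (h : IsHyperbolic a b ⊤) : 2 < a ∨ 2 < b := by
  by_contra! hab
  have ha := le_antisymm hab.1 h.two_le_left
  have hb := le_antisymm hab.2 h.two_le_mid
  have := h.chi_neg
  rw [chi, ha, hb] at this
  norm_num [recip] at this

theorem IsStandardTriple.trace_right_mul_left (h : IsStandardTriple a b c δa δb δc) :
    ((δc : Matrix (Fin 2) (Fin 2) ℝ) * δa).trace = -lam2 b := by
  have e : δc * δa = -δb⁻¹ := by
    rw [h.eq_neg_inv]; simp
  rw [← Matrix.SpecialLinearGroup.coe_mul, e, Matrix.SpecialLinearGroup.coe_neg, Matrix.trace_neg,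
    trace_inv, h.trace_mid]

theorem IsStandardTriple.trace_right_mul_mid (h : IsStandardTriple a b c δa δb δc) :
    ((δc : Matrix (Fin 2) (Fin 2) ℝ) * δb).trace = -lam2 a := by
  have e : δb * δc = -δa⁻¹ := by
    rw [h.eq_neg_inv]; simp
  rw [Matrix.trace_mul_comm, ← Matrix.SpecialLinearGroup.coe_mul, e,
    Matrix.SpecialLinearGroup.coe_neg, Matrix.trace_neg, trace_inv, h.trace_left]

theorem coe_sq (g : SL(2, ℝ)) : ((g ^ 2 : SL(2, ℝ)) : Matrix (Fin 2) (Fin 2) ℝ) =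
    (g : Matrix (Fin 2) (Fin 2) ℝ).trace • (g : Matrix (Fin 2) (Fin 2) ℝ) - 1 := by
  rw [Matrix.SpecialLinearGroup.coe_pow, pow_two, Matrix.mul_self_fin_two,
    Matrix.SpecialLinearGroup.det_coe, one_smul]

/-- With a parabolic generator, the invariant quaternion algebra is a matrix algebra. -/
theorem IsTrianglePreimage.nonempty_invariantAlgebra_algEquiv (h : IsTrianglePreimage a b ⊤ Γ) :
    Nonempty (invariantAlgebra Γ ≃ₐ[invariantTraceField Γ]
      Matrix (Fin 2) (Fin 2) (invariantTraceField Γ)) := by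
  obtain ⟨hyp, δa, δb, δc, hst, rfl⟩ := h
  set Γ := Subgroup.closure {δa, δb, δc}
  set C := (δc : Matrix (Fin 2) (Fin 2) ℝ) with hC
  have hCtr : C.trace = 2 := by rw [hC, hst.trace_right, lam2_top]
  have hN : ((δc ^ 2 : SL(2, ℝ)) : Matrix (Fin 2) (Fin 2) ℝ) - 1 = (2 : ℝ) • (C - 1) := by
    rw [coe_sq, ← hC, hCtr]
    module
  have hCC : C * C = (2 : ℝ) • C - 1 := by
    rw [Matrix.mul_self_fin_two, hCtr, hC, Matrix.SpecialLinearGroup.det_coe, one_smul]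
  have hmem {δ : SL(2, ℝ)} (hδ : δ ∈ ({δa, δb, δc} : Set SL(2, ℝ))) :
      ((δ ^ 2 : SL(2, ℝ)) : Matrix (Fin 2) (Fin 2) ℝ) ∈ invariantAlgebra Γ :=
    coe_mem_invariantAlgebra (sq_mem_squareSubgroup (Subgroup.subset_closure hδ))
  have hNA : (2 : ℝ) • (C - 1) ∈ invariantAlgebra Γ := by
    rw [← hN]
    exact sub_mem (hmem (by simp)) (one_mem _)
  have hNN : ((2 : ℝ) • (C - 1)) * ((2 : ℝ) • (C - 1)) = 0 := by
    rw [smul_mul_smul_comm, sub_mul, mul_sub, hCC, mul_one, one_mul]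
    module
  have htr (δ : SL(2, ℝ)) : (((2 : ℝ) • (C - 1)) *
      ((δ ^ 2 : SL(2, ℝ)) : Matrix (Fin 2) (Fin 2) ℝ)).trace =
        2 * (δ : Matrix (Fin 2) (Fin 2) ℝ).trace * ((C * δ).trace -
          (δ : Matrix (Fin 2) (Fin 2) ℝ).trace) := by
    rw [coe_sq, smul_mul_assoc, sub_mul, mul_sub, mul_smul_comm, mul_one, one_mul]
    simp only [Matrix.trace_smul, Matrix.trace_sub, hCtr, smul_eq_mul, Matrix.trace_one,
      Fintype.card_fin]
    push_cast
    ring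
  have ha := lam2_nonneg hyp.two_le_left
  have hb := lam2_nonneg hyp.two_le_mid
  -- For y = δ_a² or δ_b² the trace is -2λ(λ_{2a} + λ_{2b}), with λ = λ_{2a} or λ_{2b} respectively.
  -- It is nonzero as soon as that index a or b exceeds 2.
  obtain ⟨y, hyA, hy⟩ : ∃ y ∈ invariantAlgebra Γ, (((2 : ℝ) • (C - 1)) * y).trace ≠ 0 := by
    rcases hyp.two_lt_or with h2 | h2
    · refine ⟨_, hmem (δ := δa) (by simp), ?_⟩
      have := lam2_pos h2
      rw [htr, hst.trace_right_mul_left, hst.trace_left]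
      exact mul_ne_zero (by positivity) (by linarith)
    · refine ⟨_, hmem (δ := δb) (by simp), ?_⟩
      have := lam2_pos h2
      rw [htr, hst.trace_right_mul_mid, hst.trace_mid]
      exact mul_ne_zero (by positivity) (by linarith)
  refine Matrix.nonempty_subalgebra_algEquiv _ (fun _ => trace_mem_of_mem_invariantAlgebra)
    hNA hyA hNN ?_ hy
  intro h0
  rw [h0, zero_mul, Matrix.trace_zero] at hy
  exact hy rfl

theorem IsTrianglePreimage.isSplitAt (h : IsTrianglePreimage a b ⊤ Γ)
    (σ : invariantTraceField Γ →+* ℝ) : IsSplitAt (A := invariantAlgebra Γ) σ :=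
  let ⟨e⟩ := h.nonempty_invariantAlgebra_algEquiv
  isSplitAt_of_algEquiv_matrix e σ

/-! ### Counting the real places of E -/

open IntermediateField in
theorem lam2_mem_adjoin_cos {s : ℕ∞} {m : ℕ} (hm : m ≠ 0) (hs : s ≠ ⊤ → s.toNat ∣ m) :
    lam2 s ∈ ℚ⟮Real.cos (2 * Real.pi / (2 * m : ℕ))⟯ := by
  induction s with
  | top => rw [lam2_top]; exact ofNat_mem _ 2
  | coe n =>
    obtain ⟨d, rfl⟩ : n ∣ m := by simpa using hs
    rw [lam2_natCast]
    refine mul_mem (ofNat_mem _ 2) ?_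
    convert Real.cos_nat_mul_mem_adjoin (2 * Real.pi / (2 * (n * d) : ℕ)) d using 2
    have : (n : ℝ) ≠ 0 := by rintro h; simp_all
    have : (d : ℝ) ≠ 0 := by rintro h; simp_all
    push_cast
    field_simp

open IntermediateField in
theorem IsTrianglePreimage.invariantTraceField_le (h : IsTrianglePreimage a b c Γ) {m : ℕ}
    (hm : m ≠ 0) (ha : a ≠ ⊤ → a.toNat ∣ m) (hb : b ≠ ⊤ → b.toNat ∣ m)
    (hc : c ≠ ⊤ → c.toNat ∣ m) :
    invariantTraceField Γ ≤ ℚ⟮Real.cos (2 * Real.pi / (2 * m : ℕ))⟯ := by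
  obtain ⟨-, δa, δb, δc, hst, rfl⟩ := h
  refine adjoin_le_iff.mpr ?_
  rintro _ ⟨γ, hγ, rfl⟩
  exact hst.trace_mem (K := ℚ⟮Real.cos (2 * Real.pi / (2 * m : ℕ))⟯.toSubfield)
    (lam2_mem_adjoin_cos hm ha) (lam2_mem_adjoin_cos hm hb) (lam2_mem_adjoin_cos hm hc)
    (squareSubgroup_le hst.neg_one_mem hγ)

theorem trace_sq_eq {δ : SL(2, ℝ)} {n : ℕ}
    (hδ : (δ : Matrix (Fin 2) (Fin 2) ℝ).trace = lam2 n) :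
    ((δ ^ 2 : SL(2, ℝ)) : Matrix (Fin 2) (Fin 2) ℝ).trace = 2 * Real.cos (2 * Real.pi / n) := by
  rw [coe_sq, Matrix.trace_sub, Matrix.trace_smul, hδ, lam2_natCast, Matrix.trace_one,
    mul_div_assoc, Real.cos_two_mul]
  simp
  ring

theorem two_mul_cos_mem_invariantTraceField {δ : SL(2, ℝ)} (hδΓ : δ ∈ Γ) {n : ℕ}
    (hδ : (δ : Matrix (Fin 2) (Fin 2) ℝ).trace = lam2 n) :
    2 * Real.cos (2 * Real.pi / n) ∈ invariantTraceField Γ :=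
  trace_sq_eq hδ ▸ trace_mem_invariantTraceField (sq_mem_squareSubgroup hδΓ)

/-- Integers `k ≤ n / 2` prime to `2m` give distinct real places of the invariant trace field, so
they are at most as many as the arithmetic dimension. -/
theorem IsTrianglePreimage.card_le_arithmeticDimension (h : IsTrianglePreimage a b ⊤ Γ) {m : ℕ}
    (hm : m ≠ 0) (ha : a ≠ ⊤ → a.toNat ∣ m) (hb : b ≠ ⊤ → b.toNat ∣ m)
    (hΓ : arithmeticDimension Γ ≠ 0) {δ : SL(2, ℝ)} (hδΓ : δ ∈ Γ) {n : ℕ} (hn : n ∣ m)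
    (hδ : (δ : Matrix (Fin 2) (Fin 2) ℝ).trace = lam2 n) (S : Finset ℕ)
    (hS : ∀ k ∈ S, k.Coprime (2 * m) ∧ 2 * k ≤ n) : S.card ≤ arithmeticDimension Γ := by
  have hle := h.invariantTraceField_le hm ha hb (fun h => absurd rfl h)
  let x : invariantTraceField Γ := ⟨_, two_mul_cos_mem_invariantTraceField hδΓ hδ⟩
  have hn0 : (n : ℝ) ≠ 0 := by
    rintro h0
    rw [Nat.cast_eq_zero] at h0
    exact hm (zero_dvd_iff.mp (h0 ▸ hn))
  -- The embedding of ℚ(cos(2π/2m)) attached to k is restricted to E; with m = nd, the angle 2π/n is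
  -- 2d times 2π/2m.
  have hσ (k : S) : ∃ σ : invariantTraceField Γ →+* ℝ,
      σ x = 2 * Real.cos (k * (2 * Real.pi / n)) := by
    obtain ⟨φ, hφ⟩ := Real.exists_ringHom_adjoin_cos (N := 2 * m) (by lia) (hS k k.2).1
    obtain ⟨d, rfl⟩ := hn
    have hd0 : (d : ℝ) ≠ 0 := by
      rintro h0
      simp_all
    let i := IntermediateField.inclusion hle
    have hx : ((i (2⁻¹ * x) : _) : ℝ) =
        Real.cos ((2 * d : ℕ) * (2 * Real.pi / (2 * (n * d) : ℕ))) := by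
      rw [IntermediateField.coe_inclusion]
      change (2 : ℝ)⁻¹ * (2 * Real.cos (2 * Real.pi / n)) = _
      rw [inv_mul_cancel_left₀ two_ne_zero]
      congr 1
      push_cast
      field_simp
    refine ⟨φ.comp i.toRingHom, ?_⟩
    have := hφ _ _ hx
    rw [map_mul, map_mul, map_inv₀, map_inv₀, map_ofNat, map_ofNat, inv_mul_eq_iff_eq_mul₀ two_ne_zero]
      at this
    refine this.trans ?_
    congr 2
    push_cast
    field_simp
  choose σ hσx using hσ
  -- `Nat.card` of an infinite type is 0, so a nonzero dimension gives the finiteness needed to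
  -- compare cardinalities.
  have hfin := Nat.finite_of_card_ne_zero hΓ
  rw [← Fintype.card_coe, ← Nat.card_eq_fintype_card]
  refine Nat.card_le_card_of_injective (fun k => ⟨σ k, h.isSplitAt (σ k)⟩) fun k l hkl => ?_
  have e : σ k x = σ l x := by rw [(Subtype.mk.inj hkl)]
  rw [hσx, hσx, mul_right_inj' two_ne_zero] at e
  -- 2k ≤ n keeps the angle 2πk/n in [0, π], where cosine is injective.
  have hmem (k : S) : (k : ℝ) * (2 * Real.pi / n) ∈ Set.Icc 0 Real.pi := by
    have h2 : 2 * (k : ℝ) ≤ n := by exact_mod_cast (hS k k.2).2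
    have := Real.pi_pos
    refine ⟨by positivity, ?_⟩
    rw [mul_div_assoc', div_le_iff₀ (by positivity)]
    nlinarith
  have := Real.injOn_cos (hmem k) (hmem l) e
  have h3 : 2 * Real.pi / n ≠ 0 := by have := Real.pi_pos; positivity
  exact Subtype.ext (Nat.cast_injective (mul_right_cancel₀ h3 this))

theorem toNat_dvd_lcmFinite {s : ℕ∞} (hs : s = a ∨ s = b ∨ s = c) (hs' : s ≠ ⊤) :
    s.toNat ∣ lcmFinite a b c :=
  Finset.dvd_lcm (Finset.mem_erase.mpr ⟨hs', by simpa using hs⟩)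

theorem IsHyperbolic.lcmFinite_ne_zero (h : IsHyperbolic a b c) : lcmFinite a b c ≠ 0 := by
  rw [lcmFinite, Ne, Finset.lcm_eq_zero_iff]
  rintro ⟨s, hs, h0⟩
  rw [Finset.mem_erase] at hs
  have h2 : 2 ≤ s := by
    have := hs.2
    simp only [Finset.mem_insert, Finset.mem_singleton] at this
    rcases this with rfl | rfl | rfl
    exacts [h.two_le_left, h.two_le_mid, h.two_le_right]
  rcases ENat.toNat_eq_zero.mp h0 with rfl | rfl
  · simp at h2
  · exact hs.1 rfl

/-- `1` and the first `r` primes not dividing `n`. -/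
theorem IsNondividingPrime.exists_finset {r n q : ℕ} (h : IsNondividingPrime r n q) :
    ∃ S : Finset ℕ, S.card = r + 1 ∧ ∀ k ∈ S, k.Coprime n ∧ k ≤ q := by
  obtain ⟨hq, hqn, rfl⟩ := h
  refine ⟨insert 1 (insert q ((Finset.range q).filter fun p => p.Prime ∧ ¬ p ∣ n)), ?_, ?_⟩
  · rw [Finset.card_insert_of_notMem, Finset.card_insert_of_notMem]
    · simp
    · simp [hq.one_lt.ne, Nat.not_prime_one]
  · intro k hk
    simp only [Finset.mem_insert, Finset.mem_filter, Finset.mem_range] at hk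
    rcases hk with rfl | rfl | ⟨hkq, hk, hkn⟩
    · exact ⟨Nat.coprime_one_left _, hq.one_le⟩
    · exact ⟨(Nat.Prime.coprime_iff_not_dvd hq).mpr hqn, le_rfl⟩
    · exact ⟨(Nat.Prime.coprime_iff_not_dvd hk).mpr hkn, hkq.le⟩

end TriangleGroup

end

theorem proposition4p5 (r : ℕ) (hr : 1 ≤ r) (a b : ℕ∞)
    (h : TriangleGroup.IsArithmetic r a b ⊤) (q : ℕ)
    (hq : TriangleGroup.IsNondividingPrime r (2 * TriangleGroup.lcmFinite a b ⊤) q) :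
    (a ≠ ⊤ → a ≤ ((2 * q : ℕ) : ℕ∞)) ∧ (b ≠ ⊤ → b ≤ ((2 * q : ℕ) : ℕ∞)) := by
  obtain ⟨Γ, hΓ, hdim⟩ := h
  obtain ⟨S, hScard, hS⟩ := hq.exists_finset
  have key {s : ℕ∞} (hs : s = a ∨ s = b ∨ s = ⊤) (hs' : s ≠ ⊤)
      (hδ : ∃ δ ∈ Γ, (δ : Matrix (Fin 2) (Fin 2) ℝ).trace = TriangleGroup.lam2 s) :
      s ≤ ((2 * q : ℕ) : ℕ∞) := by
    obtain ⟨δ, hδΓ, hδ⟩ := hδ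
    by_contra! hlt
    have hdvd := TriangleGroup.toNat_dvd_lcmFinite hs hs'
    lift s to ℕ using hs'
    rw [Nat.cast_lt] at hlt
    -- Every k ∈ S has 2k ≤ 2q < s, so the r + 1 elements of S would give r + 1 ≤ r.
    have := hΓ.card_le_arithmeticDimension hΓ.1.lcmFinite_ne_zero
      (TriangleGroup.toNat_dvd_lcmFinite (by simp)) (TriangleGroup.toNat_dvd_lcmFinite (by simp))
      (by lia) hδΓ hdvd hδ S (fun k hk => ⟨(hS k hk).1, by have := (hS k hk).2; simp; lia⟩)
    lia
  obtain ⟨-, δa, δb, δc, hst, rfl⟩ := id hΓ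
  exact ⟨fun ha => key (by simp) ha ⟨δa, Subgroup.subset_closure (by simp), hst.trace_left⟩,
    fun hb => key (by simp) hb ⟨δb, Subgroup.subset_closure (by simp), hst.trace_mid⟩⟩
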